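/- Let $F$ be a field of characteristic $p>0$, let $K\supseteq F$ be an algebraically closed field, let $A_0$ be a unital $F$-subalgebra of $M_n(K)$, and let $A=\widetilde{A_0}$ be its Zariski closure in $M_n(K)$, with Jacobson radical $J$. Fix a Wedderburn decomposition $A=S\oplus J$ (as vector spaces), where $S=R_1\times\dots\times R_k$ is a subalgebra and each block $R_j\cong M_{n_j}(L_j)$ is a matrix algebra of degree $n_j\ge 1$ over a field $L_j\supseteq F$. An element of $A$ is semisimple of matrix degree $m$ if it lies in some $R_j$ with $n_j=m$; it is pure if it lies in $J\cup R_1\cup\dots\cup R_k$. A substitution of elements of $A$ for the indeterminates is pure if all these elements are pure. Polynomials are elements of the free associative algebra $F\{x_1,x_2,\dots\}$. A polynomial $g$ is linear in $x_i$ if $g\neq 0$ and $x_i$ occurs exactly once in each monomial of $g$. A polynomial $h$ is hiked at $x_i$ to $h_{x_i\mapsto g}$, with atom $g$, if $g$ is linear in $x_i$. We say that $f$ can be hiked to every polynomial obtained from $f$ by iterating such hikes and, whenever $f$ can be hiked to $h_1$ and to $h_2$, taking the sum $h_1+h_2$. A polynomial $\tilde f$ hiked from $f$ is uniform if $\tilde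 f=h_{x_i\mapsto g}$ for some polynomial $h$ to which $f$ can be hiked, some indeterminate $x_i$ that occurs in every monomial of $h$, and some $g$ linear in $x_i$, such that for a single integer $m$ the value of the atom $g$ is semisimple of matrix degree $m$ in every pure substitution in $A$ on which $\tilde f$ does not vanish. Proposition. Let $f$ be a polynomial with zero constant term that has a nonzero pure substitution in $A$. (If $f$ is nonconstant and additive on $A$ in each indeterminate occurring in it, this just says that $f$ is not an identity of $A$.) Then $f$ can be hiked to a uniform polynomial that still has a nonzero pure substitution in $A$. -/

import Mathlib

/-! ### Noncommutative polynomials and hiking -/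

/-- The monomials (words) occurring with nonzero coefficient in a noncommutative polynomial in the
indeterminates `x_0, x_1, …`. -/
noncomputable def ncMonomials {F : Type*} [Field F] (f : FreeAlgebra F ℕ) :
    Set (FreeMonoid ℕ) :=
  {w | (FreeAlgebra.equivMonoidAlgebraFreeMonoid f).coeff w ≠ 0}

/-- `g` is linear in `x_i`: it is nonzero and `x_i` occurs exactly once in each monomial of `g`
(the other indeterminates are unrestricted). -/
def IsLinearIn {F : Type*} [Field F] (i : ℕ) (g : FreeAlgebra F ℕ) : Prop :=
  g ≠ 0 ∧ ∀ w ∈ ncMonomials g, (FreeMonoid.toList w).count i = 1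

/-- `f_{x_i ↦ g}`: substitute `g` for `x_i` and leave all other indeterminates unchanged. -/
noncomputable def ncSubst {F : Type*} [Field F] (f : FreeAlgebra F ℕ) (i : ℕ)
    (g : FreeAlgebra F ℕ) : FreeAlgebra F ℕ :=
  FreeAlgebra.lift F (Function.update (FreeAlgebra.ι F) i g) f

/-- `Hikes f h`: the polynomial `f` can be hiked to `h`. A single hike replaces `x_i` by an atom `g`
that is linear in `x_i`; hikes are iterated, and if `f` can be hiked to several polynomials, then it
can be hiked to their sum. -/
inductive Hikes {F : Type*} [Field F] (f : FreeAlgebra F ℕ) : FreeAlgebra F ℕ → Prop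
  | refl : Hikes f f
  | hike (h : FreeAlgebra F ℕ) (i : ℕ) (g : FreeAlgebra F ℕ) :
      Hikes f h → IsLinearIn i g → Hikes f (ncSubst h i g)
  | sum (h₁ h₂ : FreeAlgebra F ℕ) : Hikes f h₁ → Hikes f h₂ → Hikes f (h₁ + h₂)

/-- The value `f(a_0, a_1, …)` of a noncommutative polynomial under the substitution `x_j ↦ a_j`. -/
noncomputable def ncEval {F : Type*} [Field F] {A : Type*} [Ring A] [Algebra F A] (a : ℕ → A)
    (f : FreeAlgebra F ℕ) : A :=
  FreeAlgebra.lift F a f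

/-! ### The Zariski closure of an algebra of matrices -/

/-- The closure of a set of matrices in the Zariski topology of `M_n(K)`: the common zeros of all
polynomials in the `n²` matrix entries, with coefficients in `K`, that vanish on the set. -/
def zariskiClosureSet {K : Type*} [Field K] {n : ℕ} (X : Set (Matrix (Fin n) (Fin n) K)) :
    Set (Matrix (Fin n) (Fin n) K) :=
  {M | ∀ P : MvPolynomial (Fin n × Fin n) K,
    (∀ N ∈ X, MvPolynomial.eval (fun ij => N ij.1 ij.2) P = 0) →
      MvPolynomial.eval (fun ij => M ij.1 ij.2) P = 0}

theorem subset_zariskiClosureSet {K : Type*} [Field K] {n : ℕ}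
    (X : Set (Matrix (Fin n) (Fin n) K)) : X ⊆ zariskiClosureSet X :=
  fun M hM _ hP => hP M hM

/-- A polynomial map that sends `X` to the closure of `Y` sends the closure of `X` there too. -/
theorem zariskiClosureSet_map {K : Type*} [Field K] {n : ℕ}
    {X Y : Set (Matrix (Fin n) (Fin n) K)}
    (φ : Matrix (Fin n) (Fin n) K → Matrix (Fin n) (Fin n) K)
    (Q : Fin n × Fin n → MvPolynomial (Fin n × Fin n) K)
    (hQ : ∀ N ij, MvPolynomial.eval (fun kl => N kl.1 kl.2) (Q ij) = φ N ij.1 ij.2)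
    (hφ : ∀ N ∈ X, φ N ∈ zariskiClosureSet Y) {M : Matrix (Fin n) (Fin n) K}
    (hM : M ∈ zariskiClosureSet X) : φ M ∈ zariskiClosureSet Y := by
  intro P hP
  have key : ∀ N : Matrix (Fin n) (Fin n) K,
      MvPolynomial.eval (fun kl => N kl.1 kl.2) (MvPolynomial.bind₁ Q P) =
        MvPolynomial.eval (fun ij => φ N ij.1 ij.2) P := by
    intro N
    have h1 := MvPolynomial.eval₂Hom_bind₁ (RingHom.id K)
      (fun kl : Fin n × Fin n => N kl.1 kl.2) Q P
    have h2 : (fun i => MvPolynomial.eval₂Hom (RingHom.id K)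
        (fun kl : Fin n × Fin n => N kl.1 kl.2) (Q i)) = fun ij => φ N ij.1 ij.2 := by
      funext ij
      exact hQ N ij
    rw [h2] at h1
    exact h1
  rw [← key]
  apply hM
  intro N hN
  rw [key]
  exact hφ N hN P hP

/-- The Zariski closure in `M_n(K)` of an `F`-subalgebra of `M_n(K)`, again an `F`-subalgebra. -/
def zariskiClosure {F K : Type*} [Field F] [Field K] [Algebra F K] {n : ℕ}
    (A₀ : Subalgebra F (Matrix (Fin n) (Fin n) K)) :
    Subalgebra F (Matrix (Fin n) (Fin n) K) where
  carrier := zariskiClosureSet (A₀ : Set (Matrix (Fin n) (Fin n) K))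
  algebraMap_mem' r := subset_zariskiClosureSet _ (A₀.algebraMap_mem r)
  add_mem' := by
    intro a b ha hb
    refine zariskiClosureSet_map (fun N => N + b)
      (fun ij => MvPolynomial.X ij + MvPolynomial.C (b ij.1 ij.2)) (by simp) ?_ ha
    intro N hN
    refine zariskiClosureSet_map (fun M => N + M)
      (fun ij => MvPolynomial.C (N ij.1 ij.2) + MvPolynomial.X ij) (by simp) ?_ hb
    intro M hM
    exact subset_zariskiClosureSet _ (A₀.add_mem hN hM)
  mul_mem' := by
    intro a b ha hb
    refine zariskiClosureSet_map (fun N => N * b)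
      (fun ij => ∑ k, MvPolynomial.X (ij.1, k) * MvPolynomial.C (b k ij.2))
      (by simp [Matrix.mul_apply]) ?_ ha
    intro N hN
    refine zariskiClosureSet_map (fun M => N * M)
      (fun ij => ∑ k, MvPolynomial.C (N ij.1 k) * MvPolynomial.X (k, ij.2))
      (by simp [Matrix.mul_apply]) ?_ hb
    intro M hM
    exact subset_zariskiClosureSet _ (A₀.mul_mem hN hM)

/-! ### Wedderburn decompositions and pure substitutions -/

/-- A choice of Wedderburn decomposition `A = S ⊕ J` of an `F`-algebra `A`: here `J` is the Jacobson
radical of `A`, `S` is a subalgebra that is a vector space complement of `J`, and `S` is identified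
with a direct product of matrix algebras (the Wedderburn blocks) of degrees `n_1, …, n_k ≥ 1` over
fields containing `F`. -/
structure WedderburnDecomposition (F : Type*) [Field F] (A : Type*) [Ring A] [Algebra F A] where
  /-- the semisimple part -/
  S : Subalgebra F A
  isCompl : IsCompl (Subalgebra.toSubmodule S) ((Ring.jacobson A).restrictScalars F)
  /-- the number of blocks -/
  k : ℕ
  /-- the matrix degrees of the blocks -/
  deg : Fin k → ℕ
  deg_pos : ∀ j, 0 < deg j
  /-- the base fields of the blocks -/
  L : Fin k → Type*
  [field : ∀ j, Field (L j)]
  [algebra : ∀ j, Algebra F (L j)]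
  /-- the identification of `S` with the product of the blocks -/
  equiv : S ≃ₐ[F] ((j : Fin k) → Matrix (Fin (deg j)) (Fin (deg j)) (L j))

attribute [instance] WedderburnDecomposition.field WedderburnDecomposition.algebra

namespace WedderburnDecomposition

/-- The `j`-th Wedderburn block, as a subset of `A`. -/
def block {F : Type*} [Field F] {A : Type*} [Ring A] [Algebra F A]
    (W : WedderburnDecomposition F A) (j : Fin W.k) : Set A :=
  {a | ∃ M : Matrix (Fin (W.deg j)) (Fin (W.deg j)) (W.L j),
    a = (W.equiv.symm (Pi.single j M) : A)}

/-- The element is semisimple of matrix degree `m`: it lies in a Wedderburn block of degree `m`. -/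
def IsSemisimpleOfDegree {F : Type*} [Field F] {A : Type*} [Ring A] [Algebra F A]
    (W : WedderburnDecomposition F A) (m : ℕ) (a : A) : Prop :=
  ∃ j, W.deg j = m ∧ a ∈ W.block j

/-- The element is pure: it lies in `J ∪ R_1 ∪ … ∪ R_k`. -/
def IsPure {F : Type*} [Field F] {A : Type*} [Ring A] [Algebra F A]
    (W : WedderburnDecomposition F A) (a : A) : Prop :=
  a ∈ Ring.jacobson A ∨ ∃ j, a ∈ W.block j

/-- The polynomial `h`, hiked from `f`, is uniform: it arises from a polynomial `h'` hiked from `f`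
by hiking some indeterminate `x_i`, present in every monomial of `h'`, to an atom `g`, and there is
a matrix degree `m` such that in every nonzero pure substitution the atom `g`, which thus appears in
every hiked monomial, is semisimple of matrix degree `m`. -/
def IsUniform {F : Type*} [Field F] {A : Type*} [Ring A] [Algebra F A]
    (W : WedderburnDecomposition F A) (f h : FreeAlgebra F ℕ) : Prop :=
  ∃ (h' : FreeAlgebra F ℕ) (i : ℕ) (g : FreeAlgebra F ℕ) (m : ℕ),
    Hikes f h' ∧ IsLinearIn i g ∧ h = ncSubst h' i g ∧
      (∀ w ∈ ncMonomials h', i ∈ FreeMonoid.toList w) ∧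
      ∀ a : ℕ → A, (∀ l, W.IsPure (a l)) → ncEval a h ≠ 0 →
        W.IsSemisimpleOfDegree m (ncEval a g)

end WedderburnDecomposition

/-! An atom can fail to be uniform in two ways: by taking radical values, or by taking values in
blocks of different degrees.

Radical values (`exists_hike_vanishing_on_jacobson`): since `f` vanishes at the origin, zeroing a
single entry `x_l` of some pure substitution changes its value. Replace `x_l` by `x_l * ∑ y_c ^ (N +
1)`, with one fresh `y_c` per block, to get `H`. Block units for the `y_c` make the sum `1`, zeros
simulate `x_l = 0`; hence zeroing a single `y_i` changes some pure value of `H`. With `z` fresh, the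
difference of `H` and its hike `y_i ↦ y_i * z` has `y_i` in every monomial, is nonzero for some pure
substitution with `z = 0`, and vanishes for `y_i` in the radical, where `y_i` and `y_i * z` have
zero `N`-th power. Such an `N` exists by `pow_eq_zero_of_mem_jacobson_zariskiClosure`; differences
are hikes by `Hikes.sub`.

Degrees (`exists_hike_isUniform`): let `m` be the largest degree of a block in which `y_i` can lie
without killing the new polynomial. Multiply `y_i` by a sum `q` of conjugates of a Capelli
polynomial with `m * m` alternating variables. It vanishes on matrices of degree below `m` and
attains `1` in degree `m`, so a nonzero value survives; degrees above `m` are excluded by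
maximality. -/

/-! ### Supports and values of noncommutative polynomials -/

section NCPolynomials

variable {F : Type*} [Field F]

/-- The polynomials all of whose monomials lie in a given set of words. -/
def ncSupported (F : Type*) [Field F] (s : Set (FreeMonoid ℕ)) :
    Submodule F (FreeAlgebra F ℕ) where
  carrier := {f | ncMonomials f ⊆ s}
  zero_mem' := by
    intro w hw
    simp [ncMonomials] at hw
  add_mem' := by
    intro f g hf hg w hw
    by_cases h : w ∈ ncMonomials f
    · exact hf h
    · refine hg fun h' => hw ?_
      have h1 : (FreeAlgebra.equivMonoidAlgebraFreeMonoid f).coeff w = 0 := not_not.1 h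
      simp [h1, h']
  smul_mem' := by
    intro c f hf w hw
    refine hf fun h' => hw ?_
    simp [h']

theorem ncSupported_mul {s t u : Set (FreeMonoid ℕ)} {f g : FreeAlgebra F ℕ}
    (hf : f ∈ ncSupported F s) (hg : g ∈ ncSupported F t)
    (h : ∀ v ∈ s, ∀ w ∈ t, v * w ∈ u) : f * g ∈ ncSupported F u := by
  classical
  intro w hw
  have hw' : w ∈ (FreeAlgebra.equivMonoidAlgebraFreeMonoid f *
      FreeAlgebra.equivMonoidAlgebraFreeMonoid g).coeff.support := by
    rw [← map_mul]
    exact Finsupp.mem_support_iff.2 hw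
  obtain ⟨a, ha, b, hb, rfl⟩ := Finset.mem_mul.1 (MonoidAlgebra.support_coeff_mul_subset _ _ hw')
  exact h a (hf (Finsupp.mem_support_iff.1 ha)) b (hg (Finsupp.mem_support_iff.1 hb))

theorem ι_mem_ncSupported {s : Set (FreeMonoid ℕ)} {l : ℕ} (h : FreeMonoid.of l ∈ s) :
    FreeAlgebra.ι F l ∈ ncSupported F s := by
  classical
  intro w hw
  have hw' : (MonoidAlgebra.single (FreeMonoid.of l) (1 : F)).coeff w ≠ 0 := by
    simpa [ncMonomials, FreeAlgebra.equivMonoidAlgebraFreeMonoid] using hw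
  rw [MonoidAlgebra.coeff_single] at hw'
  by_cases hl : FreeMonoid.of l = w
  · exact hl ▸ h
  · exact (hw' (by simp [hl])).elim

theorem algebraMap_mem_ncSupported {s : Set (FreeMonoid ℕ)} (h : 1 ∈ s) (c : F) :
    algebraMap F (FreeAlgebra F ℕ) c ∈ ncSupported F s := by
  classical
  intro w hw
  have hw' : (MonoidAlgebra.single (1 : FreeMonoid ℕ) c).coeff w ≠ 0 := by
    simpa [ncMonomials] using hw
  rw [MonoidAlgebra.coeff_single] at hw'
  by_cases hl : 1 = w
  · exact hl ▸ h
  · exact (hw' (by simp [hl])).elim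

/-- The polynomials in which the indeterminate `x_i` does not occur. -/
def ncFree (F : Type*) [Field F] (i : ℕ) : Subalgebra F (FreeAlgebra F ℕ) where
  carrier := ncSupported F {w | (FreeMonoid.toList w).count i = 0}
  mul_mem' := by
    intro f g hf hg
    refine ncSupported_mul hf hg fun v hv w hw => ?_
    simp only [Set.mem_ofPred_eq, FreeMonoid.toList_mul, List.count_append] at *
    omega
  add_mem' := fun hf hg => Submodule.add_mem _ hf hg
  algebraMap_mem' := fun c => algebraMap_mem_ncSupported (by simp) c

theorem ι_mem_ncFree {i l : ℕ} (h : l ≠ i) : FreeAlgebra.ι F l ∈ ncFree F i :=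
  ι_mem_ncSupported (by simp [FreeMonoid.toList_of, h])

theorem isLinearIn_ι_mul {i : ℕ} {q : FreeAlgebra F ℕ} (hq : q ∈ ncFree F i)
    (h0 : FreeAlgebra.ι F i * q ≠ 0) : IsLinearIn i (FreeAlgebra.ι F i * q) := by
  refine ⟨h0, ?_⟩
  have h1 : FreeAlgebra.ι F i ∈ ncSupported F {w | (FreeMonoid.toList w).count i = 1} :=
    ι_mem_ncSupported (by simp [FreeMonoid.toList_of])
  have h2 : q ∈ ncSupported F {w | (FreeMonoid.toList w).count i = 0} := hq
  change _ ∈ ncSupported F {w | (FreeMonoid.toList w).count i = 1}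
  refine ncSupported_mul h1 h2 fun v hv w hw => ?_
  simp only [Set.mem_ofPred_eq, FreeMonoid.toList_mul, List.count_append] at *
  omega

/-! ### Evaluation and telescoping of substitutions. -/

section Eval

variable {A : Type*} [Ring A] [Algebra F A]

theorem ncEval_ι (a : ℕ → A) (l : ℕ) : ncEval a (FreeAlgebra.ι F l) = a l := by simp [ncEval]

theorem ncEval_mul (a : ℕ → A) (f g : FreeAlgebra F ℕ) :
    ncEval a (f * g) = ncEval a f * ncEval a g := by simp [ncEval]

theorem ncEval_sub (a : ℕ → A) (f g : FreeAlgebra F ℕ) :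
    ncEval a (f - g) = ncEval a f - ncEval a g := by simp [ncEval]

theorem ncEval_sum {κ : Type*} (a : ℕ → A) (s : Finset κ) (f : κ → FreeAlgebra F ℕ) :
    ncEval a (∑ c ∈ s, f c) = ∑ c ∈ s, ncEval a (f c) := by simp [ncEval]

theorem ncEval_pow (a : ℕ → A) (f : FreeAlgebra F ℕ) (N : ℕ) :
    ncEval a (f ^ N) = ncEval a f ^ N := by simp [ncEval]

theorem ncEval_zero (a : ℕ → A) : ncEval a (0 : FreeAlgebra F ℕ) = 0 := by simp [ncEval]

theorem ncEval_ncSubst (a : ℕ → A) (f : FreeAlgebra F ℕ) (i : ℕ) (g : FreeAlgebra F ℕ) :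
    ncEval a (ncSubst f i g) = ncEval (Function.update a i (ncEval a g)) f := by
  have h : (FreeAlgebra.lift F a).comp
      (FreeAlgebra.lift F (Function.update (FreeAlgebra.ι F) i g)) =
      FreeAlgebra.lift F (Function.update a i (ncEval a g)) := by
    ext l
    by_cases hl : l = i
    · subst hl; simp [ncEval]
    · simp [hl]
  exact DFunLike.congr_fun h f

/-- Only finitely many indeterminates occur in a polynomial. -/
theorem exists_ncEval_congr (A : Type*) [Ring A] [Algebra F A] (f : FreeAlgebra F ℕ) :
    ∃ B : ℕ, ∀ a b : ℕ → A, (∀ l < B, a l = b l) → ncEval a f = ncEval b f := by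
  induction f using FreeAlgebra.induction with
  | grade0 r => exact ⟨0, fun a b _ => by simp [ncEval]⟩
  | grade1 x => exact ⟨x + 1, fun a b h => by simpa [ncEval] using h x (by omega)⟩
  | mul f g hf hg =>
    obtain ⟨B, hB⟩ := hf
    obtain ⟨C, hC⟩ := hg
    refine ⟨max B C, fun a b h => ?_⟩
    rw [ncEval_mul, ncEval_mul, hB a b fun l hl => h l (lt_max_of_lt_left hl),
      hC a b fun l hl => h l (lt_max_of_lt_right hl)]
  | add f g hf hg =>
    obtain ⟨B, hB⟩ := hf
    obtain ⟨C, hC⟩ := hg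
    refine ⟨max B C, fun a b h => ?_⟩
    have h1 := hB a b fun l hl => h l (lt_max_of_lt_left hl)
    have h2 := hC a b fun l hl => h l (lt_max_of_lt_right hl)
    simp only [ncEval, map_add] at *
    rw [h1, h2]

/-- A polynomial with zero constant term vanishes at the origin. -/
theorem ncEval_zero_of_const {f : FreeAlgebra F ℕ} (hf : (1 : FreeMonoid ℕ) ∉ ncMonomials f) :
    ncEval (0 : ℕ → A) f = 0 := by
  have h : (MonoidAlgebra.lift F A (FreeMonoid ℕ) (FreeMonoid.lift (0 : ℕ → A))).comp
      (FreeAlgebra.equivMonoidAlgebraFreeMonoid (R := F) (X := ℕ)).toAlgHom =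
      FreeAlgebra.lift F (0 : ℕ → A) := by
    ext l
    simp [FreeAlgebra.equivMonoidAlgebraFreeMonoid]
  have h' := DFunLike.congr_fun h f
  rw [ncEval, ← h']
  change MonoidAlgebra.lift F A (FreeMonoid ℕ) (FreeMonoid.lift (0 : ℕ → A))
    (FreeAlgebra.equivMonoidAlgebraFreeMonoid f) = 0
  rw [MonoidAlgebra.lift_apply]
  refine Finset.sum_eq_zero fun w hw => ?_
  induction w using FreeMonoid.casesOn with
  | one => exact (hf (Finsupp.mem_support_iff.1 hw)).elim
  | of_mul x xs => simp

/-- If two substitutions that differ by zeroing finitely many entries give different values, then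
zeroing a single entry changes the value of an intermediate substitution. -/
theorem exists_ncEval_update_ne {P : A → Prop} (h0 : P 0) (f : FreeAlgebra F ℕ)
    (a : ℕ → A) (ha : ∀ l, P (a l)) (s : Finset ℕ)
    (hs : ncEval a f ≠ ncEval (fun l => if l ∈ s then 0 else a l) f) :
    ∃ b : ℕ → A, (∀ l, P (b l)) ∧ ∃ i ∈ s, ncEval b f ≠ ncEval (Function.update b i 0) f := by
  induction s using Finset.induction_on generalizing a with
  | empty => simp at hs
  | insert i s hi ih =>
    by_cases h : ncEval a f = ncEval (Function.update a i 0) f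
    · obtain ⟨b, hb, j, hj, hne⟩ := ih (Function.update a i 0) (fun l => by
        by_cases hl : l = i
        · subst hl; simpa using h0
        · simpa [hl] using ha l) (by
          have he : (fun l => if l ∈ s then 0 else Function.update a i 0 l) =
              fun l => if l ∈ insert i s then 0 else a l := by
            funext l
            by_cases hl : l = i
            · subst hl; simp
            · simp [hl]
          rwa [← h, he])
      exact ⟨b, hb, j, Finset.mem_insert_of_mem hj, hne⟩
    · exact ⟨a, ha, i, Finset.mem_insert_self _ _, h⟩

end Eval

/-- Replacing `x_i` by a multiple of `x_i` changes only monomials that contain `x_i`. -/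
theorem mem_of_mem_ncMonomials_sub_ncSubst (f : FreeAlgebra F ℕ) (i : ℕ) (q : FreeAlgebra F ℕ) :
    ∀ w ∈ ncMonomials (f - ncSubst f i (FreeAlgebra.ι F i * q)), i ∈ FreeMonoid.toList w := by
  let C := ncSupported F {w | i ∈ FreeMonoid.toList w}
  have hmul : ∀ f g, (f ∈ C ∨ g ∈ C) → f * g ∈ C := by
    have htop : ∀ f : FreeAlgebra F ℕ, f ∈ ncSupported F Set.univ := fun f => Set.subset_univ _
    rintro f g (h | h)
    · exact ncSupported_mul h (htop g) fun v hv w _ => by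
        simpa using Or.inl hv
    · exact ncSupported_mul (htop f) h fun v _ w hw => by
        simpa using Or.inr hw
  have hι : FreeAlgebra.ι F i ∈ C := ι_mem_ncSupported (by simp [FreeMonoid.toList_of])
  set g := FreeAlgebra.ι F i * q with hg
  have hgC : g ∈ C := hmul _ _ (Or.inl hι)
  change f - ncSubst f i g ∈ C
  induction f using FreeAlgebra.induction with
  | grade0 r => simp [ncSubst]
  | grade1 x =>
    by_cases hx : x = i
    · subst hx
      simpa [ncSubst] using C.sub_mem hι hgC
    · simp [ncSubst, hx]
  | mul a b ha hb =>
    -- A Leibniz-type identity: each summand has a factor with `x_i` in all its monomials.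
    have h : a * b - ncSubst (a * b) i g =
        a * (b - ncSubst b i g) + (a - ncSubst a i g) * ncSubst b i g := by
      simp only [ncSubst, map_mul]
      noncomm_ring
    rw [h]
    exact C.add_mem (hmul _ _ (Or.inr hb)) (hmul _ _ (Or.inl ha))
  | add a b ha hb =>
    have h : a + b - ncSubst (a + b) i g = (a - ncSubst a i g) + (b - ncSubst b i g) := by
      simp only [ncSubst, map_add]
      abel
    rw [h]
    exact C.add_mem ha hb

/-- Hiking allows sums but no scalars; in characteristic `p`, however, `-h₂` is a sum of `p - 1`
copies of `h₂`. This is where positive characteristic enters. -/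
theorem Hikes.sub (p : ℕ) [Fact p.Prime] [CharP F p] {f h₁ h₂ : FreeAlgebra F ℕ}
    (H₁ : Hikes f h₁) (H₂ : Hikes f h₂) : Hikes f (h₁ - h₂) := by
  have key : ∀ m : ℕ, Hikes f (h₁ + m • h₂) := by
    intro m
    induction m with
    | zero => simpa using H₁
    | succ m ih =>
      rw [succ_nsmul, ← add_assoc]
      exact .sum _ _ ih H₂
  have hp : p • h₂ = 0 := by
    rw [← Nat.cast_smul_eq_nsmul F, CharP.cast_eq_zero, zero_smul]
  have h1 : (p - 1) • h₂ = -h₂ := by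
    rw [eq_neg_iff_add_eq_zero, ← succ_nsmul,
      Nat.sub_add_cancel (Fact.out : p.Prime).one_le, hp]
  simpa [h1, sub_eq_add_neg] using key (p - 1)

end NCPolynomials

/-! ### A polynomial that detects the matrix degree -/

section Capelli

/-- The Capelli polynomial, alternating in the entries of `y`. -/
def capelli {R : Type*} [Ring R] {t : ℕ} (y z w : Fin t → R) : R :=
  ∑ σ : Equiv.Perm (Fin t),
    Equiv.Perm.sign σ • (List.ofFn fun s => z s * y (σ s) * w s).prod

/-- A sum of conjugates of the Capelli polynomial. -/
def capelliConj {R : Type*} [Ring R] {t : ℕ} (m : ℕ) (y z w : Fin t → R) (u v : R) : R :=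
  ∑ c ∈ Finset.range m, u ^ (c + 1) * capelli y z w * v ^ (c + 1)

theorem map_capelli {R R' : Type*} [Ring R] [Ring R'] (φ : R →+* R') {t : ℕ}
    (y z w : Fin t → R) :
    φ (capelli y z w) = capelli (fun s => φ (y s)) (fun s => φ (z s)) (fun s => φ (w s)) := by
  simp [capelli, map_list_prod, List.map_ofFn, Function.comp_def, Units.smul_def]

theorem map_capelliConj {R R' : Type*} [Ring R] [Ring R'] (φ : R →+* R') {t : ℕ} (m : ℕ)
    (y z w : Fin t → R) (u v : R) :
    φ (capelliConj m y z w u v) = capelliConj m (fun s => φ (y s)) (fun s => φ (z s))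
      (fun s => φ (w s)) (φ u) (φ v) := by
  simp [capelliConj, map_capelli]

theorem capelli_eq_zero_of_eq_zero {R : Type*} [Ring R] {t : ℕ} {y z w : Fin t → R}
    (h : ∃ s, y s = 0 ∨ z s = 0 ∨ w s = 0) : capelli y z w = 0 := by
  obtain ⟨s, h⟩ := h
  refine Finset.sum_eq_zero fun σ _ => ?_
  rw [List.prod_eq_zero, smul_zero]
  rw [List.mem_ofFn]
  rcases h with h | h | h
  · exact ⟨σ.symm s, by simp [h]⟩
  · exact ⟨s, by simp [h]⟩
  · exact ⟨s, by simp [h]⟩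

/-- Applied modulo the radical. The exponents `c + 1`, rather than `c`, ensure that `u` and `v`
occur in every term. -/
theorem capelliConj_eq_zero_of_eq_zero {R : Type*} [Ring R] {t m : ℕ} {y z w : Fin t → R}
    {u v : R} (h : (∃ s, y s = 0 ∨ z s = 0 ∨ w s = 0) ∨ u = 0 ∨ v = 0) :
    capelliConj m y z w u v = 0 := by
  refine Finset.sum_eq_zero fun c _ => ?_
  rcases h with h | h | h
  · simp [capelli_eq_zero_of_eq_zero h]
  · simp [h]
  · simp [h]

/-- The Capelli polynomial vanishes on algebras of smaller dimension. -/
theorem capelli_eq_zero_of_finrank_lt {L R : Type*} [Field L] [Ring R] [Algebra L R]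
    [Module.Finite L R] {t : ℕ} (ht : Module.finrank L R < t) (y z w : Fin t → R) :
    capelli y z w = 0 := by
  -- The Capelli polynomial is the alternatization of `M`, and more than `finrank L R` arguments are
  -- linearly dependent.
  let M : MultilinearMap L (fun _ : Fin t => R) R :=
    (MultilinearMap.mkPiAlgebraFin L t R).compLinearMap fun s =>
      (LinearMap.mulRight L (w s)).comp (LinearMap.mulLeft L (z s))
  have h := (MultilinearMap.alternatization M).map_linearDependent y fun hy => by
    have := hy.fintype_card_le_finrank
    simp at this
    omega
  rw [MultilinearMap.alternatization_apply] at h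
  rw [← h]
  refine Finset.sum_congr rfl fun σ _ => ?_
  simp [M, MultilinearMap.domDomCongr_apply]

theorem capelliConj_matrix_eq_zero {L : Type*} [Field L] {d m t : ℕ} (hd : d * d < t)
    (y z w : Fin t → Matrix (Fin d) (Fin d) L) (u v : Matrix (Fin d) (Fin d) L) :
    capelliConj m y z w u v = 0 := by
  refine Finset.sum_eq_zero fun c _ => ?_
  rw [capelli_eq_zero_of_finrank_lt (L := L) (by simpa [Module.finrank_matrix] using hd)]
  simp

/-- On matrices of degree `m`, the polynomial takes the value `1`. -/
theorem exists_capelliConj_eq_one (L : Type*) [Field L] {m : ℕ} (hm : 0 < m) :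
    ∃ (y z w : Fin (m * m) → Matrix (Fin m) (Fin m) L) (u v : Matrix (Fin m) (Fin m) L),
      capelliConj m y z w u v = 1 := by
  classical
  have : NeZero m := ⟨hm.ne'⟩
  let r : Fin (m * m) → Fin m × Fin m := finProdFinEquiv.symm
  let e : Fin m → Fin m → Matrix (Fin m) (Fin m) L := fun a b => Matrix.single a b 1
  have he : ∀ a b c, e a b * e b c = e a c := fun a b c => by simp [e]
  have he0 : ∀ a b c d, b ≠ c → e a b * e c d = 0 := fun a b c d h => by simp [e, h]
  -- `u` is the cyclic shift, as addition in `Fin m` is modulo `m`, and `v` is its transpose.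
  let u : Matrix (Fin m) (Fin m) L := Matrix.of fun a b => if a = b + 1 then 1 else 0
  let v : Matrix (Fin m) (Fin m) L := Matrix.of fun a b => if b = a + 1 then 1 else 0
  have hu : ∀ a b, u * e a b = e (a + 1) b := by
    intro a b
    ext i j
    by_cases hj : j = b
    · subst hj
      simp [u, e, Matrix.single_apply, eq_comm]
    · simp [e, Ne.symm hj, hj]
  have hv : ∀ a b, e a b * v = e a (b + 1) := by
    intro a b
    ext i j
    by_cases hi : i = a
    · subst hi
      simp [v, e, Matrix.single_apply, eq_comm]
    · simp [e, Ne.symm hi, hi]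
  -- Each factor `e 0 a * e a b * e b 0` is `e 0 0`; any nontrivial permutation of the middle units
  -- breaks some factor.
  have hcap : capelli (fun s => e (r s).1 (r s).2) (fun s => e 0 (r s).1)
      (fun s => e (r s).2 0) = e 0 0 := by
    rw [capelli, Finset.sum_eq_single 1]
    · simp only [Equiv.Perm.sign_one, one_smul, Equiv.Perm.one_apply, he, List.ofFn_const,
        List.prod_replicate]
      have : ∀ k, e 0 0 ^ (k + 1) = e 0 0 := by
        intro k
        induction k with
        | zero => simp
        | succ k ih => rw [pow_succ, ih, he]
      obtain ⟨k, hk⟩ := Nat.exists_eq_succ_of_ne_zero (Nat.mul_pos hm hm).ne'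
      rw [hk, this]
    · intro σ _ hσ
      obtain ⟨s, hs⟩ : ∃ s, σ s ≠ s := by
        by_contra! h
        exact hσ (Equiv.ext h)
      rw [List.prod_eq_zero, smul_zero]
      rw [List.mem_ofFn]
      refine ⟨s, ?_⟩
      have hrs : r (σ s) ≠ r s := fun h => hs (finProdFinEquiv.symm.injective h)
      by_cases h1 : (r s).1 = (r (σ s)).1
      · have h2 : (r (σ s)).2 ≠ (r s).2 := fun h2 => hrs (Prod.ext h1.symm h2)
        rw [mul_assoc, he0 _ _ _ _ h2, mul_zero]
      · rw [he0 _ _ _ _ h1, zero_mul]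
    · simp
  have hsucc : ∀ c : ℕ, Fin.ofNat m (c + 1) = Fin.ofNat m c + 1 := by
    intro c
    ext
    simp [Fin.val_add]
  have hpow : ∀ c : ℕ, u ^ c * e 0 0 * v ^ c = e (Fin.ofNat m c) (Fin.ofNat m c) := by
    intro c
    induction c with
    | zero => simp
    | succ c ih =>
      calc u ^ (c + 1) * e 0 0 * v ^ (c + 1) = u * (u ^ c * e 0 0 * v ^ c) * v := by
            rw [pow_succ' u, pow_succ v]; simp only [mul_assoc]
        _ = _ := by rw [ih, hu, hv, hsucc]
  refine ⟨fun s => e (r s).1 (r s).2, fun s => e 0 (r s).1, fun s => e (r s).2 0, u, v, ?_⟩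
  rw [capelliConj, hcap]
  simp only [hpow]
  -- The exponents `1, …, m` meet every residue modulo `m` once, so the conjugates fill the
  -- diagonal.
  have h1 : ∑ c ∈ Finset.range m, e (Fin.ofNat m (c + 1)) (Fin.ofNat m (c + 1)) =
      ∑ c : Fin m, e (c + 1) (c + 1) := by
    rw [Finset.sum_range]
    refine Finset.sum_congr rfl fun c _ => ?_
    rw [hsucc, Fin.ofNat_val_eq_self]
  exact h1.trans ((Equiv.sum_comp (Equiv.addRight (1 : Fin m)) fun c => e c c).trans
    Matrix.sum_single_one)

/-- The atom `x_i * q`, where `q` is a sum of conjugates of the Capelli polynomial in the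
indeterminates listed by `ν`. -/
def capelliAtom (m i : ℕ) (ν : (Fin 3 × Fin (m * m)) ⊕ Bool → ℕ) {R : Type*} [Ring R]
    (x : ℕ → R) : R :=
  x i * capelliConj m (fun s => x (ν (.inl (0, s)))) (fun s => x (ν (.inl (1, s))))
    (fun s => x (ν (.inl (2, s)))) (x (ν (.inr false))) (x (ν (.inr true)))

theorem ncEval_capelliAtom {F : Type*} [Field F] {A : Type*} [Ring A] [Algebra F A] (m i : ℕ)
    (ν : (Fin 3 × Fin (m * m)) ⊕ Bool → ℕ) (a : ℕ → A) :
    ncEval a (capelliAtom m i ν (FreeAlgebra.ι F)) = capelliAtom m i ν a := by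
  have h := fun y z w u v =>
    map_capelliConj (t := m * m) (FreeAlgebra.lift F a).toRingHom m y z w u v
  simp only [AlgHom.toRingHom_eq_coe, RingHom.coe_coe] at h
  simp [capelliAtom, ncEval, h]

theorem isLinearIn_capelliAtom {F : Type*} [Field F] {m i : ℕ}
    {ν : (Fin 3 × Fin (m * m)) ⊕ Bool → ℕ} (hν : ∀ s, ν s ≠ i)
    (h0 : capelliAtom m i ν (FreeAlgebra.ι F) ≠ 0) :
    IsLinearIn i (capelliAtom m i ν (FreeAlgebra.ι F)) := by
  have hι := fun s => ι_mem_ncFree (F := F) (hν s)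
  refine isLinearIn_ι_mul (Subalgebra.sum_mem _ fun c _ => ?_) h0
  refine Subalgebra.mul_mem _ (Subalgebra.mul_mem _ (Subalgebra.pow_mem _ (hι _) _) ?_)
    (Subalgebra.pow_mem _ (hι _) _)
  refine Subalgebra.sum_mem _ fun σ _ => ?_
  rw [Units.smul_def]
  refine Subalgebra.zsmul_mem _ (Subalgebra.list_prod_mem _ fun x hx => ?_) _
  obtain ⟨s, rfl⟩ := List.mem_ofFn.1 hx
  exact Subalgebra.mul_mem _ (Subalgebra.mul_mem _ (hι _) (hι _)) (hι _)

end Capelli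

/-! ### The radical of a Zariski closed algebra -/

section Radical

variable {F K : Type*} [Field F] [Field K] [Algebra F K] {n : ℕ}

theorem zariskiClosureSet_idem (X : Set (Matrix (Fin n) (Fin n) K)) :
    zariskiClosureSet (zariskiClosureSet X) = zariskiClosureSet X :=
  Set.Subset.antisymm (fun _ hM P hP => hM P fun _ hN => hN P hP) (subset_zariskiClosureSet _)

/-- The closures of the sets of high powers of a matrix stabilize. -/
theorem exists_pow_mem_zariskiClosureSet (z : Matrix (Fin n) (Fin n) K) :
    ∃ k₀ : ℕ, ∀ j i, k₀ ≤ i → z ^ i ∈ zariskiClosureSet ((fun l => z ^ l) '' Set.Ici j) := by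
  -- `I j` is the vanishing ideal of the powers from `z ^ j` on; this ascending chain stabilizes.
  let I : ℕ →o Ideal (MvPolynomial (Fin n × Fin n) K) :=
    { toFun := fun j => ⨅ l : Set.Ici j,
        RingHom.ker (MvPolynomial.eval fun ij : Fin n × Fin n => (z ^ (l : ℕ)) ij.1 ij.2)
      monotone' := fun j j' h => le_iInf fun l =>
        iInf_le_of_le ⟨l, le_trans h l.2⟩ le_rfl }
  have hI : ∀ j P, P ∈ I j ↔ ∀ l ∈ Set.Ici j,
      MvPolynomial.eval (fun ij : Fin n × Fin n => (z ^ l) ij.1 ij.2) P = 0 := by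
    intro j P
    change P ∈ ⨅ l : Set.Ici j, _ ↔ _
    simp [RingHom.mem_ker]
  obtain ⟨k₀, hk⟩ := monotone_stabilizes_iff_noetherian.2
    (inferInstance : IsNoetherian (MvPolynomial (Fin n × Fin n) K)
      (MvPolynomial (Fin n × Fin n) K)) I
  refine ⟨k₀, fun j i hi P hP => ?_⟩
  have h1 : P ∈ I (max j k₀) := I.monotone (le_max_left _ _) <| (hI _ _).2 fun l hl =>
    hP _ ⟨l, hl, rfl⟩
  rw [← hk _ (le_max_right _ _)] at h1
  exact (hI _ _).1 h1 i hi

/-- Some power of a matrix `z` is divisible by the next one, with a quotient commuting with `z`. -/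
theorem Matrix.exists_pow_eq_pow_succ_mul (z : Matrix (Fin n) (Fin n) K) :
    ∃ (k : ℕ) (s : Matrix (Fin n) (Fin n) K), Commute z s ∧ z ^ k = z ^ (k + 1) * s := by
  -- Write the characteristic polynomial as `X ^ k * q` with `q(0) ≠ 0`; Cayley–Hamilton then lets
  -- one solve for `z ^ k`.
  obtain ⟨q, hq, hX⟩ := Polynomial.exists_eq_pow_rootMultiplicity_mul_and_not_dvd z.charpoly
    (Matrix.charpoly_monic z).ne_zero 0
  set k := z.charpoly.rootMultiplicity 0
  simp only [map_zero, sub_zero] at hq hX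
  have hc : q.coeff 0 ≠ 0 := fun h => hX (Polynomial.X_dvd_iff.2 h)
  have h0 : z ^ k * Polynomial.aeval z q = 0 := by
    rw [← Matrix.aeval_self_charpoly z, hq]
    simp
  have h1 : Polynomial.aeval z q =
      z * Polynomial.aeval z q.divX + algebraMap K _ (q.coeff 0) := by
    have h := congrArg (Polynomial.aeval z) (Polynomial.X_mul_divX_add q)
    simpa only [map_add, map_mul, Polynomial.aeval_X, Polynomial.aeval_C] using h.symm
  refine ⟨k, -((q.coeff 0)⁻¹ • Polynomial.aeval z q.divX), ?_, ?_⟩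
  · refine (Commute.smul_right ?_ _).neg_right
    have h := Commute.all (Polynomial.X : Polynomial K) q.divX
    simpa using h.map (Polynomial.aeval z)
  · rw [h1, mul_add, ← mul_assoc, ← pow_succ, Algebra.algebraMap_eq_smul_one, mul_smul_comm,
      mul_one] at h0
    rw [mul_neg, mul_smul_comm, eq_neg_of_add_eq_zero_left h0, smul_neg, smul_smul,
      inv_mul_cancel₀ hc, one_smul, neg_neg]

theorem pow_add_mul_pow_of_pow_eq {R : Type*} [Ring R] {z s : R} {k : ℕ}
    (h : z ^ k = z ^ (k + 1) * s) (c : ℕ) {i : ℕ} (hi : k ≤ i) : z ^ (i + c) * s ^ c = z ^ i := by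
  induction c with
  | zero => simp
  | succ c ih =>
    obtain ⟨d, hd⟩ := Nat.exists_eq_add_of_le (le_add_right hi : k ≤ i + c)
    calc z ^ (i + (c + 1)) * s ^ (c + 1) = z ^ d * (z ^ (k + 1) * s) * s ^ c := by
          rw [pow_succ' s, ← add_assoc, hd, ← mul_assoc, ← mul_assoc, ← pow_add]
          congr 3
          omega
      _ = z ^ i := by rw [← h, ← pow_add, add_comm d k, ← hd, ih]

/-- For `x` in the radical, `1 - r * x` has a left inverse, and it annihilates `y`. -/
theorem eq_zero_of_mul_mul_eq_self {R : Type*} [Ring R] {x r y : R} (hx : x ∈ Ring.jacobson R)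
    (h : r * x * y = y) : y = 0 := by
  rw [← Ideal.jacobson_bot, Ideal.mem_jacobson_iff] at hx
  obtain ⟨c, hc⟩ := hx (-r)
  have hc' : c * (1 - r * x) = 1 := by
    have := sub_eq_zero.1 ((Submodule.mem_bot _).1 hc)
    rwa [mul_neg, neg_mul, mul_assoc, neg_add_eq_sub, ← mul_one_sub] at this
  calc y = c * (1 - r * x) * y := by rw [hc', one_mul]
    _ = c * (y - r * x * y) := by rw [mul_assoc, sub_mul, one_mul]
    _ = 0 := by rw [h, sub_self, mul_zero]

/-- The elements of the radical of a Zariski closed algebra are nilpotent. -/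
theorem pow_eq_zero_of_mem_jacobson_zariskiClosure
    (A₀ : Subalgebra F (Matrix (Fin n) (Fin n) K)) (x : zariskiClosure A₀)
    (hx : x ∈ Ring.jacobson (zariskiClosure A₀)) : x ^ n = 0 := by
  set z : Matrix (Fin n) (Fin n) K := x.1 with hz
  obtain ⟨k₀, hk₀⟩ := exists_pow_mem_zariskiClosureSet z
  obtain ⟨k, s, hs, hzs⟩ := Matrix.exists_pow_eq_pow_succ_mul z
  set i := max k₀ k with hi
  have hik : k ≤ i := le_max_right _ _
  -- `s` itself need not lie in the algebra. But `s ^ (i + 1)` sends all powers of `z` from exponent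
  -- `2 * i + 1` on to powers of `z`, and `z ^ i` lies in the closure of these powers.
  have hr : s ^ (i + 1) * z ^ i ∈ zariskiClosure A₀ := by
    have hA : zariskiClosureSet (A₀ : Set (Matrix (Fin n) (Fin n) K)) = zariskiClosure A₀ := rfl
    change _ ∈ zariskiClosureSet _
    rw [← zariskiClosureSet_idem, hA]
    refine zariskiClosureSet_map (fun M => s ^ (i + 1) * M)
      (fun ij => ∑ l, MvPolynomial.C ((s ^ (i + 1)) ij.1 l) * MvPolynomial.X (l, ij.2))
      (by simp [Matrix.mul_apply]) ?_ (hk₀ (i + (i + 1)) i (le_max_left _ _))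
    rintro _ ⟨l, hl, rfl⟩
    obtain ⟨d, rfl⟩ := Nat.exists_eq_add_of_le (Set.mem_Ici.1 hl)
    refine subset_zariskiClosureSet _ ?_
    have h1 : s ^ (i + 1) * z ^ (i + (i + 1) + d) = z ^ (i + d) := by
      rw [← (hs.pow_pow _ _).eq, add_right_comm, pow_add_mul_pow_of_pow_eq hzs _ (by omega)]
    change s ^ (i + 1) * z ^ (i + (i + 1) + d) ∈ _
    rw [h1]
    exact (x ^ (i + d)).2
  have hr1 : (s ^ (i + 1) * z ^ i) * z * z ^ i = z ^ i := by
    rw [mul_assoc, mul_assoc, ← pow_succ', ← pow_add, ← (hs.pow_pow _ _).eq,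
      pow_add_mul_pow_of_pow_eq hzs _ hik]
  let r : zariskiClosure A₀ := ⟨_, hr⟩
  have hr2 : r * x * x ^ i = x ^ i := Subtype.ext hr1
  have hxi : x ^ i = 0 := eq_zero_of_mul_mul_eq_self hx hr2
  -- The exponent `i` depends on `x`; Cayley–Hamilton replaces it by `n`.
  have hnil : IsNilpotent z := ⟨i, by
    have := congrArg (Subtype.val) hxi
    simpa using this⟩
  have hch : z.charpoly = Polynomial.X ^ n := by
    have h := (Matrix.isNilpotent_charpoly_sub_pow_of_isNilpotent hnil).eq_zero
    simpa [sub_eq_zero] using h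
  have h := Matrix.aeval_self_charpoly z
  rw [hch] at h
  exact Subtype.ext (by simpa using h)

end Radical

/-! ### Hiking to a uniform polynomial -/

namespace WedderburnDecomposition

variable {F : Type*} [Field F] {A : Type*} [Ring A] [Algebra F A]
  (W : WedderburnDecomposition F A)

/-- The product of the Wedderburn blocks, mapped into the algebra. -/
noncomputable def blockHom :
    ((j : Fin W.k) → Matrix (Fin (W.deg j)) (Fin (W.deg j)) (W.L j)) →ₐ[F] A :=
  W.S.val.comp W.equiv.symm.toAlgHom

theorem blockHom_mem_block (j : Fin W.k) (M : Matrix (Fin (W.deg j)) (Fin (W.deg j)) (W.L j)) :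
    W.blockHom (Pi.single j M) ∈ W.block j := ⟨M, rfl⟩

theorem isPure_blockHom (j : Fin W.k) (M : Matrix (Fin (W.deg j)) (Fin (W.deg j)) (W.L j)) :
    W.IsPure (W.blockHom (Pi.single j M)) := Or.inr ⟨j, W.blockHom_mem_block j M⟩

theorem isPure_zero : W.IsPure 0 := Or.inl (Submodule.zero_mem _)

theorem single_mul (j : Fin W.k) (M : Matrix (Fin (W.deg j)) (Fin (W.deg j)) (W.L j))
    (b : (j : Fin W.k) → Matrix (Fin (W.deg j)) (Fin (W.deg j)) (W.L j)) :
    Pi.single j M * b = Pi.single j (M * b j) := (Pi.single_mul_left _).symm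

theorem sum_single_one : ∑ j : Fin W.k, W.blockHom (Pi.single j 1) = 1 := by
  rw [← map_sum]
  have h := Finset.univ_sum_single
    (1 : (j : Fin W.k) → Matrix (Fin (W.deg j)) (Fin (W.deg j)) (W.L j))
  simp only [Pi.one_apply] at h
  rw [h, map_one]

theorem single_one_pow (j : Fin W.k) (N : ℕ) :
    W.blockHom (Pi.single j 1) ^ (N + 1) = W.blockHom (Pi.single j 1) := by
  induction N with
  | zero => simp
  | succ N ih => rw [pow_succ, ih, ← map_mul, single_mul]; simp

theorem isPure_update {a : ℕ → A} (ha : ∀ l, W.IsPure (a l)) (i : ℕ) {b : A} (hb : W.IsPure b)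
    (l : ℕ) : W.IsPure (Function.update a i b l) := by
  by_cases h : l = i
  · subst h; simpa using hb
  · simpa [h] using ha l

/-- A pure value of `x * capelliConj` outside the radical lies in the block of `x`, and this block
has sufficiently large matrix degree. -/
theorem mul_capelliConj_mem {m : ℕ} {x : A} {y z w : Fin (m * m) → A} {u v : A} (hx : W.IsPure x)
    (hy : ∀ s, W.IsPure (y s)) (hz : ∀ s, W.IsPure (z s)) (hw : ∀ s, W.IsPure (w s))
    (hu : W.IsPure u) (hv : W.IsPure v) :
    x * capelliConj m y z w u v ∈ Ring.jacobson A ∨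
      ∃ j, m ≤ W.deg j ∧ x * capelliConj m y z w u v ∈ W.block j := by
  by_cases hxJ : x ∈ Ring.jacobson A
  · exact Or.inl (Ideal.mul_mem_right _ _ hxJ)
  -- Every variable of `capelliConj` occurs in each of its terms, so one radical entry makes the
  -- value radical.
  by_cases hJ : (∃ s, y s ∈ Ring.jacobson A ∨ z s ∈ Ring.jacobson A ∨ w s ∈ Ring.jacobson A) ∨
      u ∈ Ring.jacobson A ∨ v ∈ Ring.jacobson A
  · refine Or.inl (Ideal.mul_mem_left _ _ ?_)
    rw [← Ideal.Quotient.eq_zero_iff_mem, map_capelliConj]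
    refine capelliConj_eq_zero_of_eq_zero ?_
    simpa only [Ideal.Quotient.eq_zero_iff_mem] using hJ
  push Not at hJ
  have key : ∀ a : A, W.IsPure a → a ∉ Ring.jacobson A → ∃ b, a = W.blockHom b := by
    rintro a (ha | ⟨j, M, ha⟩) ha'
    · exact (ha' ha).elim
    · exact ⟨_, ha⟩
  choose y' hy' using fun s => key _ (hy s) (hJ.1 s).1
  choose z' hz' using fun s => key _ (hz s) (hJ.1 s).2.1
  choose w' hw' using fun s => key _ (hw s) (hJ.1 s).2.2
  obtain ⟨u', hu'⟩ := key _ hu hJ.2.1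
  obtain ⟨v', hv'⟩ := key _ hv hJ.2.2
  obtain ⟨j, M, hM⟩ := hx.resolve_left hxJ
  have hG : x * capelliConj m y z w u v =
      W.blockHom (Pi.single j (M * capelliConj m y' z' w' u' v' j)) := by
    have h := map_capelliConj W.blockHom.toRingHom m y' z' w' u' v'
    simp only [AlgHom.toRingHom_eq_coe, RingHom.coe_coe, ← hy', ← hz', ← hw', ← hu', ← hv'] at h
    rw [← single_mul, map_mul, h, hM]
    rfl
  rw [hG]
  by_cases hm : m ≤ W.deg j
  · exact Or.inr ⟨j, hm, W.blockHom_mem_block j _⟩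
  · left
    have h := map_capelliConj (Pi.evalRingHom
      (fun j => Matrix (Fin (W.deg j)) (Fin (W.deg j)) (W.L j)) j) m y' z' w' u' v'
    rw [capelliConj_matrix_eq_zero (Nat.mul_self_lt_mul_self (not_le.1 hm))] at h
    simp only [Pi.evalRingHom_apply] at h
    simp [h]

/-- If the radical is nil of bounded index, a polynomial with a nonzero pure substitution can be
hiked so that some indeterminate occurs in every monomial and cannot take radical values. -/
theorem exists_hike_vanishing_on_jacobson (p : ℕ) [Fact p.Prime] [CharP F p] {N : ℕ}
    (hN : ∀ x ∈ Ring.jacobson A, x ^ N = 0) (f : FreeAlgebra F ℕ)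
    (hconst : (1 : FreeMonoid ℕ) ∉ ncMonomials f)
    (hf : ∃ a : ℕ → A, (∀ l, W.IsPure (a l)) ∧ ncEval a f ≠ 0) :
    ∃ (h : FreeAlgebra F ℕ) (i : ℕ), Hikes f h ∧
      (∀ w ∈ ncMonomials h, i ∈ FreeMonoid.toList w) ∧
      (∀ a : ℕ → A, a i ∈ Ring.jacobson A → ncEval a h = 0) ∧
      ∃ a : ℕ → A, (∀ l, W.IsPure (a l)) ∧ ncEval a h ≠ 0 := by
  obtain ⟨B, hB⟩ := exists_ncEval_congr A f
  obtain ⟨a, ha, ha0⟩ := hf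
  obtain ⟨b, hb, l, hl, hne⟩ := exists_ncEval_update_ne W.isPure_zero f a ha (Finset.range B) (by
    rw [hB (fun l => if l ∈ Finset.range B then 0 else a l) 0 fun t ht => by simp [ht],
      ncEval_zero_of_const hconst]
    exact ha0)
  have hlB : l < B := Finset.mem_range.1 hl
  -- Indeterminates from `B` on do not affect `f`. The exponent is positive even for `N = 0`, so
  -- zeros kill the sum and block units are fixed.
  set g : FreeAlgebra F ℕ :=
    FreeAlgebra.ι F l * ∑ c : Fin W.k, FreeAlgebra.ι F (B + c) ^ (N + 1) with hg
  have hgv : ∀ a : ℕ → A, ncEval a g = a l * ∑ c : Fin W.k, a (B + c) ^ (N + 1) := by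
    intro a
    simp only [hg, ncEval_mul, ncEval_ι, ncEval_sum, ncEval_pow]
  set H := ncSubst f l g with hH
  have hHv : ∀ a a' : ℕ → A, (∀ t < B, t ≠ l → a t = a' t) → ncEval a g = a' l →
      ncEval a H = ncEval a' f := by
    intro a a' h hl'
    rw [hH, ncEval_ncSubst]
    refine hB _ _ fun t ht => ?_
    by_cases htl : t = l
    · subst htl; simpa using hl'
    · simpa [htl] using h t ht htl
  let e : ℕ → A := fun t =>
    if h : B ≤ t ∧ t < B + W.k then W.blockHom (Pi.single ⟨t - B, by omega⟩ 1) else b t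
  have he : ∀ t < B, e t = b t := fun t ht => dif_neg (by omega)
  have he' : ∀ c : Fin W.k, e (B + c) = W.blockHom (Pi.single c 1) := by
    intro c
    have hc : B ≤ B + (c : ℕ) ∧ B + (c : ℕ) < B + W.k := ⟨by omega, by omega⟩
    simp only [e, dif_pos hc]
    have hcc : (⟨B + c - B, by omega⟩ : Fin W.k) = c := Fin.ext (by simp)
    rw [hcc]
  have heg : ncEval e g = b l := by
    simp only [hgv, he', he l hlB, single_one_pow, sum_single_one, mul_one]
  have hep : ∀ t, W.IsPure (e t) := by
    intro t
    by_cases h : B ≤ t ∧ t < B + W.k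
    · simp only [e, dif_pos h]; exact W.isPure_blockHom _ _
    · simp only [e, dif_neg h]; exact hb t
  have hg0 : g ≠ 0 := by
    intro h0
    rw [h0, ncEval_zero] at heg
    rw [heg, Function.update_eq_self] at hne
    exact hne rfl
  have hglin : IsLinearIn l g := isLinearIn_ι_mul
    (Subalgebra.sum_mem _ fun c _ => Subalgebra.pow_mem _ (ι_mem_ncFree (by omega)) _) hg0
  -- Telescoping again, now only over the fresh indeterminates.
  obtain ⟨c, hc, i, hi, hci⟩ := exists_ncEval_update_ne W.isPure_zero H e hep
    (Finset.Ico B (B + W.k)) (by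
      rw [hHv e b (fun t ht _ => he t ht) heg,
        hHv _ (Function.update b l 0) (fun t ht htl => by simp [htl, he t ht, ht]) ?_]
      · exact hne
      · simp [hgv])
  obtain ⟨hi1, hi2⟩ := Finset.mem_Ico.1 hi
  have hHcongr : ∀ a a' : ℕ → A, (∀ t < B + W.k, a t = a' t) → ncEval a H = ncEval a' H := by
    intro a a' h
    rw [hHv a (Function.update a' l (ncEval a' g)) (fun t ht htl => by simp [htl, h t (by omega)])]
    · rw [hH, ncEval_ncSubst]
    · simp only [hgv, Function.update_self, h l (by omega)]
      congr 1
      exact Finset.sum_congr rfl fun d _ => by rw [h _ (by omega)]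
  have hy0 : FreeAlgebra.ι F i * FreeAlgebra.ι F (B + W.k) ≠ 0 := by
    intro h
    have := ncEval_mul (fun _ => (1 : F)) (FreeAlgebra.ι F i) (FreeAlgebra.ι F (B + W.k))
    simp [h, ncEval_ι, ncEval_zero] at this
  have hylin := isLinearIn_ι_mul (i := i) (ι_mem_ncFree (F := F) (by omega)) hy0
  have hHike : Hikes f H := .hike _ _ _ .refl hglin
  refine ⟨H - ncSubst H i (FreeAlgebra.ι F i * FreeAlgebra.ι F (B + W.k)), i,
    hHike.sub p (.hike _ _ _ hHike hylin), mem_of_mem_ncMonomials_sub_ncSubst _ _ _, ?_, ?_⟩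
  · intro a hai
    rw [ncEval_sub, ncEval_ncSubst a H, sub_eq_zero, ncEval_mul, ncEval_ι, ncEval_ι]
    rw [hHv a (Function.update a l (ncEval a g)) (fun t ht htl => by simp [htl]) (by simp)]
    symm
    refine hHv _ _ (fun t ht htl => ?_) ?_
    · rw [Function.update_of_ne (by omega), Function.update_of_ne htl]
    · rw [Function.update_self, hgv, hgv, Function.update_of_ne (by omega)]
      congr 1
      refine Finset.sum_congr rfl fun d _ => ?_
      by_cases hd : B + (d : ℕ) = i
      · rw [hd, Function.update_self, pow_succ, pow_succ, hN _ hai,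
          hN _ (Ideal.mul_mem_right _ _ hai), zero_mul, zero_mul]
      · rw [Function.update_of_ne hd]
  -- With the last indeterminate zero, the subtracted term is `H` with `x_i` zeroed.
  · refine ⟨Function.update c (B + W.k) 0, W.isPure_update hc _ W.isPure_zero, ?_⟩
    rw [ncEval_sub, ncEval_ncSubst _ H, sub_ne_zero, ncEval_mul, ncEval_ι, ncEval_ι,
      Function.update_self, mul_zero]
    rw [hHcongr _ c fun t ht => Function.update_of_ne (by omega) _ _,
      hHcongr (Function.update (Function.update c (B + W.k) 0) i 0) (Function.update c i 0)
        fun t ht => ?_]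
    · exact hci
    · by_cases hti : t = i
      · subst hti; simp
      · rw [Function.update_of_ne hti, Function.update_of_ne hti, Function.update_of_ne (by omega)]

/-- The degree bounds come from opposite sides: the Capelli factor excludes smaller blocks, and
maximality excludes larger ones. -/
theorem exists_hike_isUniform (p : ℕ) [Fact p.Prime] [CharP F p] {N : ℕ}
    (hN : ∀ x ∈ Ring.jacobson A, x ^ N = 0) (f : FreeAlgebra F ℕ)
    (hconst : (1 : FreeMonoid ℕ) ∉ ncMonomials f)
    (hf : ∃ a : ℕ → A, (∀ l, W.IsPure (a l)) ∧ ncEval a f ≠ 0) :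
    ∃ h : FreeAlgebra F ℕ, Hikes f h ∧ W.IsUniform f h ∧
      ∃ a : ℕ → A, (∀ l, W.IsPure (a l)) ∧ ncEval a h ≠ 0 := by
  classical
  obtain ⟨h, i, hfh, hmon, hJ, a₀, ha₀, hne₀⟩ :=
    W.exists_hike_vanishing_on_jacobson p hN f hconst hf
  let T : Finset (Fin W.k) := Finset.univ.filter fun j =>
    ∃ a : ℕ → A, (∀ l, W.IsPure (a l)) ∧ ncEval a h ≠ 0 ∧ a i ∈ W.block j
  have hT : ∀ a : ℕ → A, (∀ l, W.IsPure (a l)) → ncEval a h ≠ 0 → ∀ j, a i ∈ W.block j → j ∈ T :=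
    fun a ha hne j hj => Finset.mem_filter.2 ⟨Finset.mem_univ _, a, ha, hne, hj⟩
  have hTne : T.Nonempty := by
    obtain ⟨j, hj⟩ := (ha₀ i).resolve_left fun hi => hne₀ (hJ _ hi)
    exact ⟨j, hT a₀ ha₀ hne₀ j hj⟩
  obtain ⟨j, hjT, hjmax⟩ := T.exists_max_image W.deg hTne
  obtain ⟨-, a, ha, hne, M, hM⟩ := Finset.mem_filter.1 hjT
  obtain ⟨B, hB⟩ := exists_ncEval_congr A h
  let ν : (Fin 3 × Fin (W.deg j * W.deg j)) ⊕ Bool → ℕ := fun s =>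
    max B (i + 1) + Encodable.encode s
  have hν : Function.Injective ν := fun s t hst => Encodable.encode_injective (by
    simpa [ν] using hst)
  have hνi : ∀ s, ν s ≠ i := fun s => by simp only [ν]; omega
  have hνB : ∀ s, B ≤ ν s := fun s => by simp only [ν]; omega
  set g := capelliAtom (W.deg j) i ν (FreeAlgebra.ι F) with hg
  have hgv : ∀ a : ℕ → A, ncEval a g = capelliAtom (W.deg j) i ν a :=
    ncEval_capelliAtom (W.deg j) i ν
  obtain ⟨y, z, w, u, v, hq⟩ := exists_capelliConj_eq_one (W.L j) (W.deg_pos j)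
  let val : (Fin 3 × Fin (W.deg j * W.deg j)) ⊕ Bool →
      Matrix (Fin (W.deg j)) (Fin (W.deg j)) (W.L j) :=
    Sum.elim (fun s => ![y, z, w] s.1 s.2) fun s => bif s then v else u
  -- The Capelli factor becomes the unit of block `j`, so the atom takes the value `a i`.
  let a' : ℕ → A := Function.extend ν (fun s => W.blockHom (Pi.single j (val s))) a
  have ha'ν : ∀ s, a' (ν s) = W.blockHom (Pi.single j (val s)) := fun s => hν.extend_apply _ _ s
  have ha'B : ∀ l, l < max B (i + 1) → a' l = a l := fun l hl =>
    Function.extend_apply' _ _ _ (by rintro ⟨s, rfl⟩; simp only [ν] at hl; omega)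
  have ha' : ∀ l, W.IsPure (a' l) := by
    intro l
    by_cases hl : ∃ s, ν s = l
    · obtain ⟨s, rfl⟩ := hl
      rw [ha'ν]
      exact W.isPure_blockHom _ _
    · simp only [a', Function.extend_apply' _ _ _ hl]
      exact ha l
  have ha'g : ncEval a' g = a i := by
    have hM' : a i = W.blockHom (Pi.single j M) := hM
    rw [hgv, capelliAtom, ha'B i (by omega), hM']
    simp only [ha'ν]
    have h1 := map_capelliConj W.blockHom.toRingHom (W.deg j)
      (fun s => Pi.single j (val (.inl (0, s)))) (fun s => Pi.single j (val (.inl (1, s))))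
      (fun s => Pi.single j (val (.inl (2, s)))) (Pi.single j (val (.inr false)))
      (Pi.single j (val (.inr true)))
    have h2 := map_capelliConj (Pi.evalRingHom
      (fun j => Matrix (Fin (W.deg j)) (Fin (W.deg j)) (W.L j)) j) (W.deg j)
      (fun s => Pi.single j (val (.inl (0, s)))) (fun s => Pi.single j (val (.inl (1, s))))
      (fun s => Pi.single j (val (.inl (2, s)))) (Pi.single j (val (.inr false)))
      (Pi.single j (val (.inr true)))
    simp only [AlgHom.toRingHom_eq_coe, RingHom.coe_coe] at h1
    simp only [Pi.evalRingHom_apply, Pi.single_eq_same] at h2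
    have h3 : capelliConj (W.deg j) (fun s => val (.inl (0, s))) (fun s => val (.inl (1, s)))
        (fun s => val (.inl (2, s))) (val (.inr false)) (val (.inr true)) = 1 := hq
    rw [← h1, ← map_mul, single_mul, h2, h3, mul_one]
  have hval : ncEval a' (ncSubst h i g) = ncEval a h := by
    rw [ncEval_ncSubst, ha'g]
    refine hB _ _ fun l hl => ?_
    by_cases hli : l = i
    · subst hli; simp
    · rw [Function.update_of_ne hli, ha'B l (by omega)]
  have hg0 : g ≠ 0 := by
    intro h0
    rw [h0, ncEval_zero] at ha'g
    exact hne (hJ a (by rw [← ha'g]; exact Submodule.zero_mem _))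
  have hglin : IsLinearIn i g := isLinearIn_capelliAtom hνi hg0
  refine ⟨ncSubst h i g, .hike _ _ _ hfh hglin, ⟨h, i, g, W.deg j, hfh, hglin, rfl, hmon, ?_⟩,
    a', ha', ?_⟩
  · intro b hb hbne
    rw [ncEval_ncSubst] at hbne
    have hbJ : ncEval b g ∉ Ring.jacobson A := fun hmem => hbne (hJ _ (by simpa using hmem))
    obtain ⟨j', hmj, hj'⟩ : ∃ j', W.deg j ≤ W.deg j' ∧ ncEval b g ∈ W.block j' := by
      rw [hgv] at hbJ ⊢
      exact (W.mul_capelliConj_mem (hb _) (fun _ => hb _) (fun _ => hb _) (fun _ => hb _) (hb _)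
        (hb _)).resolve_left hbJ
    -- Putting the atom's value in for `x_i` keeps the substitution pure and `h` nonzero, so `j'`
    -- lies in `T`.
    exact ⟨j', le_antisymm (hjmax j' (hT _ (W.isPure_update hb i (Or.inr ⟨j', hj'⟩)) hbne j'
      (by simpa using hj'))) hmj, hj'⟩
  · rw [hval]
    exact hne

end WedderburnDecomposition

theorem mainTheorem5 (p : ℕ) [Fact p.Prime] {F K : Type*} [Field F] [CharP F p] [Field K]
    [IsAlgClosed K] [Algebra F K] {n : ℕ} (A₀ : Subalgebra F (Matrix (Fin n) (Fin n) K))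
    (W : WedderburnDecomposition F (zariskiClosure A₀)) (f : FreeAlgebra F ℕ)
    (hconst : (1 : FreeMonoid ℕ) ∉ ncMonomials f)
    (hf : ∃ a : ℕ → zariskiClosure A₀, (∀ l, W.IsPure (a l)) ∧ ncEval a f ≠ 0) :
    ∃ h : FreeAlgebra F ℕ, Hikes f h ∧ W.IsUniform f h ∧
      ∃ a : ℕ → zariskiClosure A₀, (∀ l, W.IsPure (a l)) ∧ ncEval a h ≠ 0 :=
  W.exists_hike_isUniform p (pow_eq_zero_of_mem_jacobson_zariskiClosure A₀) f hconst hf
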